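/- A set $A$ in a topological space $Z$ is called $\omega N$ if it is countable and nowhere dense in $Z$, and $C_2$ if it is second countable in the subspace topology. For a property $P$ of subsets, $Z$ is called $P$-bounded if every $A\subseteq Z$ with property $P$ has compact closure in $Z$; for $Y\subseteq Z$ the $P$-closure of $Y$ in $Z$ is $\mathrm{cl}^P_Z(Y)=\bigcup\{\overline{A} : A\subseteq Y,\ A \text{ has property } P\}$ (closures in $Z$), and $Y$ is $P$-closed in $Z$ if $Y=\mathrm{cl}^P_Z(Y)$. Let $\beta\mathbb{Q}\supseteq\mathbb{Q}$ be the Čech–Stone compactification of the rationals. A remote point of $\mathbb{Q}$ is a point $p\in\beta\mathbb{Q}\setminus\mathbb{Q}$ that does not lie in the closure in $\beta\mathbb{Q}$ of any nowhere dense subset of $\mathbb{Q}$. Let $X=\mathrm{cl}^{\omega N}_{\beta\mathbb{Q}}(\mathbb{Q})$, with the subspace topology from $\beta\mathbb{Q}$. Then (in ZFC) $X$ is $\omega N$-closed in $\beta\mathbb{Q}$, and $X$ is $\omega N$-bounded. Moreover, $\mathbb{Q}$ has a remote point, and no remote point of $\mathbb{Q}$ belongs to $X$. The space $X$ is not compact,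 although it contains $\mathbb{Q}$ as a dense second countable subspace. Consequently $X$ is not $C_2$-bounded. -/

import Mathlib

/-- A space `X` is `P`-bounded, for a property `P` of subspaces of `X`, if every subspace of `X`
with property `P` has compact closure in `X`. -/
def PBounded {X : Type*} [TopologicalSpace X] (P : Set X → Prop) : Prop :=
  ∀ A : Set X, P A → IsCompact (closure A)

/-- The `P`-closure of `Y` in `X`: the union of the closures in `X` of all subsets of `Y` that
have property `P`. -/
def pClosure {X : Type*} [TopologicalSpace X] (P : Set X → Prop) (Y : Set X) : Set X :=
  ⋃ A ∈ {A : Set X | A ⊆ Y ∧ P A}, closure A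

/-- `Y` is `P`-closed in `X` if it equals its `P`-closure in `X`. -/
def IsPClosed {X : Type*} [TopologicalSpace X] (P : Set X → Prop) (Y : Set X) : Prop :=
  Y = pClosure P Y

/-- The property `ωN`: countable and nowhere dense in the ambient space. -/
def OmegaN {X : Type*} [TopologicalSpace X] (A : Set X) : Prop :=
  A.Countable ∧ IsNowhereDense A

/-- The property `C₂`: second countable in the subspace topology. -/
def CTwo {X : Type*} [TopologicalSpace X] (A : Set X) : Prop :=
  SecondCountableTopology A

/-- A remote point of `X`: a point of `βX ∖ X` that is not in the closure in `βX` of any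
nowhere dense subset of `X`. -/
def IsRemotePoint (X : Type*) [TopologicalSpace X] (p : StoneCech X) : Prop :=
  p ∉ Set.range (stoneCechUnit : X → StoneCech X) ∧
    ∀ D : Set X, IsNowhereDense D → p ∉ closure (stoneCechUnit '' D)

/-- The copy of `ℚ` in its Čech–Stone compactification `βℚ`. -/
def ratInBeta : Set (StoneCech ℚ) :=
  Set.range (stoneCechUnit : ℚ → StoneCech ℚ)

/-- The `ωN`-closure of `ℚ` in `βℚ`. -/
def omegaNClosureRat : Set (StoneCech ℚ) :=
  pClosure OmegaN ratInBeta

/-!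
In a separable regular space `Z`, a countable nowhere dense set of points, each of which lies in
the closure of an `ωN` subset of `Y`, lies in the closure of a single `ωN` subset of `Y`: shrink the
`n`-th of the given subsets so that it avoids the first few of countably many open sets with dense
union; the union of the shrunken sets is then locally, on a dense open set, a finite union. So
the `ωN`-closure of `Y` contains the closures of all its `ωN` subsets.

A remote point of `X` is obtained as in van Douwen's theorem. Regard a countable `π`-base as a poset
in which the members whose closures miss a given nowhere dense set are dense. For each `n` one can
attach to every nowhere dense set a finite union of such members so that any `n` of these unions
meet. Doing this inside the `n`-th term of a locally finite sequence of open sets and taking unions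
over `n` gives closed sets with the finite intersection property, one disjoint from each nowhere
dense set, and any point of `βX` in all their closures is remote. Such a point is missing from the
`ωN`-closure of `X` in `βX`, which is dense and hence not compact.
-/

open Set Topology TopologicalSpace

section NowhereDense

variable {Z : Type*} [TopologicalSpace Z]

theorem isNowhereDense_union {s t : Set Z} (hs : IsNowhereDense s) (ht : IsNowhereDense t) :
    IsNowhereDense (s ∪ t) := by
  rw [IsNowhereDense] at hs ⊢
  rw [closure_union, interior_union_isClosed_of_interior_empty isClosed_closure ht, hs]

theorem isNowhereDense_biUnion_of_finite {ι : Type*} {I : Set ι} (hI : I.Finite) {s : ι → Set Z}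
    (hs : ∀ i ∈ I, IsNowhereDense (s i)) : IsNowhereDense (⋃ i ∈ I, s i) := by
  induction I, hI using Set.Finite.induction_on with
  | empty => simp
  | insert _ _ ih =>
    rw [biUnion_insert]
    exact isNowhereDense_union (hs _ (mem_insert _ _))
      (ih fun i hi ↦ hs i (mem_insert_of_mem _ hi))

theorem dense_compl_closure_of_isNowhereDense {s : Set Z} (hs : IsNowhereDense s) :
    Dense (closure s)ᶜ :=
  interior_eq_empty_iff_dense_compl.1 hs

theorem isNowhereDense_singleton [T1Space Z] [PerfectSpace Z] (z : Z) :
    IsNowhereDense ({z} : Set Z) := by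
  rw [isClosed_singleton.isNowhereDense_iff]
  exact interior_singleton z

theorem isNowhereDense_preimage_of_isDenseInducing {Y : Type*} [TopologicalSpace Y] {f : Y → Z}
    (hf : IsDenseInducing f) {s : Set Z} (hs : IsNowhereDense s) : IsNowhereDense (f ⁻¹' s) := by
  have hdense : Dense (f ⁻¹' (closure s)ᶜ) := by
    rw [hf.isInducing.dense_iff]
    intro y
    rw [image_preimage_eq_inter_range]
    exact (dense_compl_closure_of_isNowhereDense hs).inter_of_isOpen_left hf.dense
      isClosed_closure.isOpen_compl _
  have hclosed : IsClosed (f ⁻¹' closure s) := isClosed_closure.preimage hf.continuous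
  refine IsNowhereDense.mono (preimage_mono subset_closure) (hclosed.isNowhereDense_iff.2 ?_)
  exact interior_eq_empty_iff_dense_compl.2 hdense

theorem isNowhereDense_of_dense_iUnion {ι : Sort*} {U : ι → Set Z} (hUo : ∀ i, IsOpen (U i))
    (hUd : Dense (⋃ i, U i)) {s : Set Z} (hs : ∀ i, IsNowhereDense (U i ∩ s)) :
    IsNowhereDense s := by
  by_contra hne
  obtain ⟨z, hz, hzU⟩ := hUd.inter_open_nonempty _ isOpen_interior (nonempty_iff_ne_empty.2 hne)
  obtain ⟨i, hzi⟩ := mem_iUnion.1 hzU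
  have hsub : U i ∩ interior (closure s) ⊆ closure (U i ∩ s) :=
    (inter_subset_inter_right _ interior_subset).trans (hUo i).inter_closure
  have hmem := interior_maximal hsub ((hUo i).inter isOpen_interior) ⟨hzi, hz⟩
  rwa [hs i] at hmem

theorem isNowhereDense_iUnion_sdiff {C U : ℕ → Set Z} (hC : ∀ n, IsNowhereDense (C n))
    (hUo : ∀ i, IsOpen (U i)) (hUd : Dense (⋃ i, U i)) :
    IsNowhereDense (⋃ n, C n \ ⋃ i ≤ n, closure (U i)) := by
  refine isNowhereDense_of_dense_iUnion hUo hUd fun i ↦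
    (isNowhereDense_biUnion_of_finite (finite_Iio i) fun n _ ↦ hC n).mono ?_
  rintro z ⟨hzU, hz⟩
  obtain ⟨n, hzC, hzn⟩ := mem_iUnion.1 hz
  refine mem_iUnion₂.2 ⟨n, ?_, hzC⟩
  by_contra! hin
  exact hzn (mem_iUnion₂.2 ⟨i, not_lt.1 hin, subset_closure hzU⟩)

theorem exists_seq_isOpen_dense_iUnion [RegularSpace Z] [SeparableSpace Z] [Nonempty Z]
    {A : Set Z} (hA : IsNowhereDense A) :
    ∃ U : ℕ → Set Z, (∀ i, IsOpen (U i)) ∧ (∀ i, Disjoint (closure (U i)) (closure A)) ∧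
      Dense (⋃ i, U i) := by
  obtain ⟨Q, hQc, hQd⟩ := exists_countable_dense Z
  have hEd : Dense (Q ∩ (closure A)ᶜ) :=
    hQd.inter_of_isOpen_right (dense_compl_closure_of_isNowhereDense hA)
      isClosed_closure.isOpen_compl
  obtain ⟨e, he⟩ := (hQc.mono inter_subset_left).exists_eq_range hEd.nonempty
  have hnhd (i : ℕ) : ∃ U, (e i ∈ U ∧ IsOpen U) ∧ closure U ⊆ (closure A)ᶜ := by
    have hi : e i ∈ Q ∩ (closure A)ᶜ := he ▸ mem_range_self i
    exact (hasBasis_opens_closure (e i)).mem_iff.1 (isClosed_closure.isOpen_compl.mem_nhds hi.2)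
  choose U hU hUA using hnhd
  refine ⟨U, fun i ↦ (hU i).2, fun i ↦ subset_compl_iff_disjoint_right.1 (hUA i), hEd.mono ?_⟩
  rw [he]
  exact range_subset_iff.2 fun i ↦ mem_iUnion.2 ⟨i, (hU i).1⟩

end NowhereDense

section PClosure

variable {Z : Type*} [TopologicalSpace Z] {P : Set Z → Prop} {A Y : Set Z}

theorem mem_pClosure {z : Z} : z ∈ pClosure P Y ↔ ∃ A ⊆ Y, P A ∧ z ∈ closure A := by
  simp [pClosure, and_assoc]

theorem closure_subset_pClosure (hAY : A ⊆ Y) (hA : P A) : closure A ⊆ pClosure P Y :=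
  fun _ hz ↦ mem_pClosure.2 ⟨A, hAY, hA, hz⟩

theorem subset_pClosure (hY : ∀ y ∈ Y, P {y}) : Y ⊆ pClosure P Y := fun y hy ↦
  closure_subset_pClosure (singleton_subset_iff.2 hy) (hY y hy) (subset_closure rfl)

theorem compactSpace_of_pBounded_of_dense (hP : PBounded P) (hA : P A) (hd : Dense A) :
    CompactSpace Z :=
  ⟨hd.closure_eq ▸ hP A hA⟩

theorem cTwo_preimage_val {s : Set Z} (hs : CTwo s) (t : Set Z) :
    CTwo (Subtype.val ⁻¹' s : Set t) := by
  have : SecondCountableTopology s := hs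
  have hind : IsInducing fun x : (Subtype.val ⁻¹' s : Set t) ↦ (⟨x.1.1, x.2⟩ : s) :=
    (IsInducing.subtypeVal.comp IsInducing.subtypeVal).codRestrict _
  exact hind.secondCountableTopology

variable [RegularSpace Z] [SeparableSpace Z]

/- If `A = {aₙ}` and `aₙ ∈ closure Cₙ`, the union of the `Cₙ` may be somewhere dense. Removing from
`Cₙ` the first `n + 1` of countably many open sets with dense union, whose closures miss that
of `A`, keeps `aₙ` in the closure, and only finitely many `Cₙ` then meet each open set. -/
theorem exists_omegaN_subset_closure (hA : OmegaN A) (hAY : A ⊆ pClosure OmegaN Y) :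
    ∃ B ⊆ Y, OmegaN B ∧ A ⊆ closure B := by
  rcases A.eq_empty_or_nonempty with rfl | hne
  · exact ⟨∅, empty_subset _, hA, empty_subset _⟩
  have : Nonempty Z := ⟨hne.some⟩
  obtain ⟨U, hUo, hUA, hUd⟩ := exists_seq_isOpen_dense_iUnion hA.2
  obtain ⟨a, rfl⟩ := hA.1.exists_eq_range hne
  choose C hCY hC haC using fun n ↦ mem_pClosure.1 (hAY (mem_range_self n))
  refine ⟨⋃ n, C n \ ⋃ i ≤ n, closure (U i), iUnion_subset fun n ↦ sdiff_subset.trans (hCY n),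
    ⟨countable_iUnion fun n ↦ (hC n).1.mono sdiff_subset,
      isNowhereDense_iUnion_sdiff (fun n ↦ (hC n).2) hUo hUd⟩, range_subset_iff.2 fun n ↦ ?_⟩
  have hclosed : IsClosed (⋃ i ≤ n, closure (U i)) :=
    (finite_Iic n).isClosed_biUnion fun _ _ ↦ isClosed_closure
  have han : a n ∉ ⋃ i ≤ n, closure (U i) := by
    simp only [mem_iUnion, not_exists]
    exact fun i _ hi ↦ (hUA i).notMem_of_mem_left hi (subset_closure (mem_range_self n))
  exact closure_mono (subset_iUnion _ n) (hclosed.isOpen_compl.closure_inter ⟨haC n, han⟩)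

theorem closure_subset_pClosure_omegaN (hA : OmegaN A) (hAY : A ⊆ pClosure OmegaN Y) :
    closure A ⊆ pClosure OmegaN Y := by
  obtain ⟨B, hBY, hB, hAB⟩ := exists_omegaN_subset_closure hA hAY
  exact (closure_minimal hAB isClosed_closure).trans (closure_subset_pClosure hBY hB)

theorem isPClosed_pClosure_omegaN (Y : Set Z) : IsPClosed OmegaN (pClosure OmegaN Y) := by
  refine Subset.antisymm (fun z hz ↦ ?_) fun z hz ↦ ?_
  · obtain ⟨A, hAY, hA, hzA⟩ := mem_pClosure.1 hz
    exact closure_subset_pClosure (subset_closure.trans (closure_subset_pClosure hAY hA)) hA hzA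
  · obtain ⟨A, hAY, hA, hzA⟩ := mem_pClosure.1 hz
    exact closure_subset_pClosure_omegaN hA hAY hzA

theorem pBounded_pClosure_omegaN [CompactSpace Z] (Y : Set Z) :
    PBounded (OmegaN : Set (pClosure OmegaN Y) → Prop) := by
  intro A hA
  have hcl : closure (Subtype.val '' A) ⊆ pClosure OmegaN Y :=
    closure_subset_pClosure_omegaN ⟨hA.1.image _, hA.2.image_val⟩ (Subtype.coe_image_subset _ A)
  rw [IsInducing.subtypeVal.closure_eq_preimage_closure_image A]
  exact IsInducing.subtypeVal.isCompact_preimage' isClosed_closure.isCompact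
    (by rwa [Subtype.range_coe])

end PClosure

section Linked

variable {α ι : Type*} [Preorder α] {𝒟 : ι → Set α}

/- Refine `a` first inside the `𝒟 i` that reaches the smallest rank: the refinement is then
still within the rank bound of every other index, and the induction goes on below it. -/
theorem exists_common_lowerBound_of_rank_le {rank : α → ℕ} {ρ : ι → ℕ → ℕ}
    (hρ_le : ∀ i, id ≤ ρ i)
    (hρ : ∀ i k a, rank a ≤ k → ∃ b ∈ 𝒟 i, b ≤ a ∧ rank b ≤ ρ i k) (k : ℕ) (S : Finset ι) (t : ℕ)
    (a : α) (ha : ∀ i ∈ S, rank a ≤ (ρ i)^[t] k) :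
    ∃ l ≤ a, ∀ i ∈ S, ∃ b ∈ 𝒟 i, b ≤ a ∧ rank b ≤ (ρ i)^[t + S.card] k ∧ l ≤ b := by
  classical
  induction S using Finset.strongInduction generalizing t a with
  | H S ih =>
    rcases S.eq_empty_or_nonempty with rfl | hS
    · exact ⟨a, le_rfl, by simp⟩
    obtain ⟨j, hj, hmin⟩ := S.exists_min_image (fun i ↦ (ρ i)^[t + 1] k) hS
    obtain ⟨c, hcD, hca, hc⟩ := hρ j _ a (ha j hj)
    rw [← Function.iterate_succ_apply' (ρ j)] at hc
    obtain ⟨l, hlc, hl⟩ := ih (S.erase j) (Finset.erase_ssubset hj) (t + 1) c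
      fun i hi ↦ hc.trans (hmin i (Finset.mem_of_mem_erase hi))
    have hcard : t + 1 + (S.erase j).card = t + S.card := by
      rw [← Finset.card_erase_add_one hj]; omega
    refine ⟨l, hlc.trans hca, fun i hi ↦ ?_⟩
    obtain rfl | hij := eq_or_ne i j
    · have hmono : (ρ i)^[t + 1] k ≤ (ρ i)^[t + S.card] k :=
        Function.monotone_iterate_of_id_le (hρ_le i) (by omega) k
      exact ⟨c, hcD, hca, hc.trans hmono, hlc⟩
    · obtain ⟨b, hbD, hbc, hb, hlb⟩ := hl i (Finset.mem_erase.2 ⟨hij, hi⟩)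
      exact ⟨b, hbD, hbc.trans hca, hcard ▸ hb, hlb⟩

theorem exists_finite_linked [Countable α] (h𝒟 : ∀ i a, ∃ b ∈ 𝒟 i, b ≤ a) (a : α) (n : ℕ) :
    ∃ s : ι → Set α, (∀ i, (s i).Finite ∧ s i ⊆ 𝒟 i ∩ Iic a) ∧
      ∀ S : Finset ι, S.card ≤ n → ∃ l, ∀ i ∈ S, ∃ b ∈ s i, l ≤ b := by
  obtain ⟨rank, hrank⟩ := exists_injective_nat α
  have hfin (k : ℕ) : {b | rank b ≤ k}.Finite := (finite_Iic k).preimage hrank.injOn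
  have hbound (i : ι) (k : ℕ) :
      ∃ m, k ≤ m ∧ ∀ c, rank c ≤ k → ∃ b ∈ 𝒟 i, b ≤ c ∧ rank b ≤ m := by
    choose r hrD hr using h𝒟 i
    obtain ⟨m, hm⟩ := ((hfin k).image fun c ↦ rank (r c)).bddAbove
    exact ⟨max k m, le_max_left _ _, fun c hc ↦
      ⟨r c, hrD c, hr c, (hm (mem_image_of_mem _ hc)).trans (le_max_right _ _)⟩⟩
  choose ρ hρ_le hρ using hbound
  refine ⟨fun i ↦ {b ∈ 𝒟 i ∩ Iic a | rank b ≤ (ρ i)^[n] (rank a)},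
    fun i ↦ ⟨(hfin _).subset fun _ hb ↦ hb.2, sep_subset _ _⟩, fun S hS ↦ ?_⟩
  obtain ⟨l, -, hl⟩ := exists_common_lowerBound_of_rank_le hρ_le hρ (rank a) S 0 a fun _ _ ↦ le_rfl
  refine ⟨l, fun i hi ↦ ?_⟩
  obtain ⟨b, hbD, hba, hb, hlb⟩ := hl i hi
  have hmono : (ρ i)^[0 + S.card] (rank a) ≤ (ρ i)^[n] (rank a) :=
    Function.monotone_iterate_of_id_le (hρ_le i) (by omega) _
  exact ⟨b, ⟨⟨hbD, hba⟩, hb.trans hmono⟩, hlb⟩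

end Linked

section RemotePoint

variable {X : Type*} [TopologicalSpace X]

/-- A `π`-base of `X`: a family of nonempty open sets such that every nonempty open set contains
one of them. Remote points are built out of the members of a countable `π`-base. -/
structure IsPiBase (𝓑 : Set (Set X)) : Prop where
  isOpen : ∀ B ∈ 𝓑, IsOpen B
  nonempty : ∀ B ∈ 𝓑, B.Nonempty
  exists_subset : ∀ U : Set X, IsOpen U → U.Nonempty → ∃ B ∈ 𝓑, B ⊆ U

theorem isPiBase_countableBasis [SecondCountableTopology X] : IsPiBase (countableBasis X) where
  isOpen _ := isOpen_of_mem_countableBasis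
  nonempty _ := nonempty_of_mem_countableBasis
  exists_subset _ hU := fun ⟨_, hx⟩ ↦
    let ⟨B, hB, _, hBU⟩ := (isBasis_countableBasis X).exists_subset_of_mem_open hx hU
    ⟨B, hB, hBU⟩

theorem IsPiBase.exists_subset_disjoint_closure [RegularSpace X] {𝓑 : Set (Set X)}
    (h𝓑 : IsPiBase 𝓑) {D B : Set X} (hD : IsNowhereDense D) (hB : B ∈ 𝓑) :
    ∃ B' ∈ 𝓑, B' ⊆ B ∧ Disjoint (closure B') (closure D) := by
  have hBo := h𝓑.isOpen B hB
  obtain ⟨x, hxB, hxD⟩ :=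
    (dense_compl_closure_of_isNowhereDense hD).inter_open_nonempty B hBo (h𝓑.nonempty B hB)
  obtain ⟨V, ⟨hxV, hVo⟩, hV⟩ := (hasBasis_opens_closure x).mem_iff.1
    ((hBo.inter isClosed_closure.isOpen_compl).mem_nhds ⟨hxB, hxD⟩)
  obtain ⟨B', hB', hBV⟩ := h𝓑.exists_subset V hVo ⟨x, hxV⟩
  have hsub : closure B' ⊆ B ∩ (closure D)ᶜ := (closure_mono hBV).trans hV
  exact ⟨B', hB', subset_closure.trans (hsub.trans inter_subset_left),
    subset_compl_iff_disjoint_right.1 (hsub.trans inter_subset_right)⟩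

section Fip

variable [RegularSpace X] {𝓑 : Set (Set X)} {ι : Type*} {D : ι → Set X}

theorem exists_linked_isClosed (h𝓑 : IsPiBase 𝓑) (h𝓑c : 𝓑.Countable)
    (hD : ∀ i, IsNowhereDense (D i)) {U : Set X} (hU : IsOpen U) (hUne : U.Nonempty) (n : ℕ) :
    ∃ F : ι → Set X, (∀ i, IsClosed (F i) ∧ F i ⊆ closure U ∧ Disjoint (F i) (closure (D i))) ∧
      ∀ S : Finset ι, S.card ≤ n → (⋂ i ∈ S, F i).Nonempty := by
  have : Countable 𝓑 := h𝓑c.to_subtype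
  obtain ⟨B₀, hB₀, hBU⟩ := h𝓑.exists_subset U hU hUne
  have hdense (i : ι) (B : 𝓑) : ∃ B' ∈ {C : 𝓑 | Disjoint (closure C.1) (closure (D i))}, B' ≤ B :=
    let ⟨B', hB', hsub, hdisj⟩ := h𝓑.exists_subset_disjoint_closure (hD i) B.2
    ⟨⟨B', hB'⟩, hdisj, hsub⟩
  obtain ⟨s, hs, hlinked⟩ := exists_finite_linked hdense ⟨B₀, hB₀⟩ n
  refine ⟨fun i ↦ ⋃ B ∈ s i, closure B.1, fun i ↦ ⟨?_, ?_, ?_⟩, fun S hS ↦ ?_⟩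
  · exact (hs i).1.isClosed_biUnion fun _ _ ↦ isClosed_closure
  · exact iUnion₂_subset fun B hB ↦ closure_mono (Subset.trans ((hs i).2 hB).2 hBU)
  · exact disjoint_iUnion₂_left.2 fun B hB ↦ ((hs i).2 hB).1
  · obtain ⟨L, hL⟩ := hlinked S hS
    obtain ⟨x, hx⟩ := h𝓑.nonempty L.1 L.2
    refine ⟨x, mem_iInter₂.2 fun i hi ↦ ?_⟩
    obtain ⟨B, hB, hLB⟩ := hL i hi
    exact mem_iUnion₂.2 ⟨B, hB, subset_closure (hLB hx)⟩

/- An `n`-linked system inside `closure (U n)` for every `n`: any `k` of the unions meet already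
inside `closure (U k)`, while local finiteness keeps the unions closed. -/
theorem exists_fip_isClosed (h𝓑 : IsPiBase 𝓑) (h𝓑c : 𝓑.Countable)
    (hD : ∀ i, IsNowhereDense (D i)) {U : ℕ → Set X} (hUo : ∀ n, IsOpen (U n))
    (hUne : ∀ n, (U n).Nonempty) (hU : LocallyFinite U) :
    ∃ F : ι → Set X, (∀ i, IsClosed (F i)) ∧ (∀ i, Disjoint (F i) (closure (D i))) ∧
      ∀ S : Finset ι, (⋂ i ∈ S, F i).Nonempty := by
  choose F hF hlinked using fun n ↦ exists_linked_isClosed h𝓑 h𝓑c hD (hUo n) (hUne n) n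
  refine ⟨fun i ↦ ⋃ n, F n i, fun i ↦ ?_, fun i ↦ ?_, fun S ↦ ?_⟩
  · exact (hU.closure.subset fun n ↦ (hF n i).2.1).isClosed_iUnion fun n ↦ (hF n i).1
  · exact disjoint_iUnion_left.2 fun n ↦ (hF n i).2.2
  · exact (hlinked S.card S le_rfl).mono (iInter₂_mono fun i _ ↦ subset_iUnion (F · i) S.card)

end Fip

theorem closure_image_stoneCechUnit_subset_preimage {K : Type*} [TopologicalSpace K]
    [CompactSpace K] [T2Space K] {g : X → K} (hg : Continuous g) {s : Set X} {t : Set K}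
    (ht : IsClosed t) (hst : MapsTo g s t) :
    closure (stoneCechUnit '' s) ⊆ stoneCechExtend hg ⁻¹' t := by
  refine closure_minimal ?_ (ht.preimage (continuous_stoneCechExtend hg))
  rintro _ ⟨x, hx, rfl⟩
  rw [mem_preimage, stoneCechExtend_stoneCechUnit]
  exact hst hx

theorem disjoint_closure_image_stoneCechUnit [NormalSpace X] {s t : Set X} (hs : IsClosed s)
    (ht : IsClosed t) (hst : Disjoint s t) :
    Disjoint (closure (stoneCechUnit '' s)) (closure (stoneCechUnit '' t)) := by
  obtain ⟨f, hf₀, hf₁, hf⟩ := exists_continuous_zero_one_of_isClosed hs ht hst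
  let g : X → Icc (0 : ℝ) 1 := fun x ↦ ⟨f x, hf x⟩
  have hg : Continuous g := f.continuous.subtype_mk _
  have hs₀ : closure (stoneCechUnit '' s) ⊆ stoneCechExtend hg ⁻¹' {0} :=
    closure_image_stoneCechUnit_subset_preimage hg isClosed_singleton
      fun x hx ↦ Subtype.ext (hf₀ hx)
  have ht₁ : closure (stoneCechUnit '' t) ⊆ stoneCechExtend hg ⁻¹' {1} :=
    closure_image_stoneCechUnit_subset_preimage hg isClosed_singleton
      fun x hx ↦ Subtype.ext (hf₁ hx)
  have h01 : Disjoint ({0} : Set (Icc (0 : ℝ) 1)) {1} := disjoint_singleton.2 zero_ne_one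
  exact (h01.preimage _).mono hs₀ ht₁

theorem exists_isRemotePoint [T4Space X] [PerfectSpace X] {𝓑 : Set (Set X)} (h𝓑 : IsPiBase 𝓑)
    (h𝓑c : 𝓑.Countable) {U : ℕ → Set X} (hUo : ∀ n, IsOpen (U n)) (hUne : ∀ n, (U n).Nonempty)
    (hU : LocallyFinite U) : ∃ p : StoneCech X, IsRemotePoint X p := by
  obtain ⟨F, hFc, hFd, hF⟩ := exists_fip_isClosed
    (D := fun D : {D : Set X // IsNowhereDense D} ↦ D.1) h𝓑 h𝓑c Subtype.prop hUo hUne hU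
  obtain ⟨p, hp⟩ : (⋂ D, closure ((stoneCechUnit : X → StoneCech X) '' F D)).Nonempty := by
    refine CompactSpace.iInter_nonempty (fun _ ↦ isClosed_closure) fun S ↦ ?_
    obtain ⟨x, hx⟩ := hF S
    exact ⟨stoneCechUnit x, mem_iInter₂.2 fun D hD ↦
      subset_closure (mem_image_of_mem _ (mem_iInter₂.1 hx D hD))⟩
  have hremote (D : Set X) (hD : IsNowhereDense D) : p ∉ closure (stoneCechUnit '' D) := fun hpD ↦
    (disjoint_closure_image_stoneCechUnit (hFc ⟨D, hD⟩) isClosed_closure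
      (hFd ⟨D, hD⟩)).notMem_of_mem_left (mem_iInter.1 hp ⟨D, hD⟩)
      (closure_mono (image_mono subset_closure) hpD)
  refine ⟨p, ?_, hremote⟩
  rintro ⟨x, rfl⟩
  exact hremote {x} (isNowhereDense_singleton x) (subset_closure (mem_image_of_mem _ rfl))

/- With `f` a filter without cluster points, every point has a closed neighbourhood whose
complement belongs to `f`; countably many of these cover, and the complements of their finite
unions form the sequence. -/
theorem exists_locallyFinite_seq_isOpen [RegularSpace X] [LindelofSpace X] [NoncompactSpace X] :
    ∃ U : ℕ → Set X, (∀ n, IsOpen (U n)) ∧ (∀ n, (U n).Nonempty) ∧ LocallyFinite U := by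
  obtain ⟨f, hf, hcluster⟩ : ∃ f : Filter X, f.NeBot ∧ ∀ x, ¬ ClusterPt x f := by
    simpa [IsCompact] using NoncompactSpace.noncompact_univ (X := X)
  have hnhd (x : X) : ∃ t ∈ 𝓝 x, IsClosed t ∧ tᶜ ∈ f := by
    have hdisj : Disjoint (𝓝 x) f := disjoint_iff.2 (Filter.not_neBot.1 (hcluster x))
    obtain ⟨t, ⟨ht, htc⟩, htf⟩ := ((closed_nhds_basis x).disjoint_iff_left).1 hdisj
    exact ⟨t, ht, htc, htf⟩
  choose t ht htc htf using hnhd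
  obtain ⟨S, hSc, hS⟩ := LindelofSpace.elim_nhds_subcover (fun x ↦ interior (t x))
    fun x ↦ interior_mem_nhds.2 (ht x)
  have : Nonempty X := Filter.nonempty_of_neBot f
  obtain ⟨e, he⟩ := countable_iff_exists_subset_range.1 hSc
  refine ⟨fun n ↦ ⋂ k ∈ Iic n, (t (e k))ᶜ, fun n ↦ ?_, fun n ↦ ?_, fun x ↦ ?_⟩
  · exact (finite_Iic n).isOpen_biInter fun k _ ↦ (htc (e k)).isOpen_compl
  · exact f.nonempty_of_mem ((Filter.biInter_mem (finite_Iic n)).2 fun k _ ↦ htf (e k))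
  · obtain ⟨y, hyS, hxy⟩ := mem_iUnion₂.1 (hS.symm ▸ mem_univ x)
    obtain ⟨k, rfl⟩ := he hyS
    refine ⟨t (e k), mem_interior_iff_mem_nhds.1 hxy, (finite_Iio k).subset ?_⟩
    rintro n ⟨z, hzU, hzt⟩
    by_contra hkn
    exact mem_iInter₂.1 hzU k (mem_Iic.2 (notMem_Iio.1 hkn)) hzt

end RemotePoint

section OmegaNClosure

variable (X : Type*) [TopologicalSpace X]

/-- The `ωN`-closure of `X` in its Čech–Stone compactification, with `X` identified with its image
under `stoneCechUnit`; `omegaNClosureRat` is the case `X = ℚ`. -/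
def omegaNClosure : Set (StoneCech X) :=
  pClosure OmegaN (range (stoneCechUnit : X → StoneCech X))

variable {X}

theorem range_stoneCechUnit_subset_omegaNClosure [T35Space X] [PerfectSpace X] :
    range (stoneCechUnit : X → StoneCech X) ⊆ omegaNClosure X := by
  refine subset_pClosure ?_
  rintro _ ⟨x, rfl⟩
  have hx : IsNowhereDense (stoneCechUnit '' {x}) :=
    isInducing_stoneCechUnit.isNowhereDense_image (isNowhereDense_singleton x)
  exact ⟨countable_singleton _, by rwa [image_singleton] at hx⟩

theorem dense_omegaNClosure [T35Space X] [PerfectSpace X] : Dense (omegaNClosure X) :=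
  denseRange_stoneCechUnit.mono range_stoneCechUnit_subset_omegaNClosure

theorem dense_preimage_range_stoneCechUnit [T35Space X] [PerfectSpace X] :
    Dense (Subtype.val ⁻¹' range stoneCechUnit : Set (omegaNClosure X)) := by
  rw [Subtype.dense_iff, Subtype.image_preimage_coe,
    inter_eq_right.2 range_stoneCechUnit_subset_omegaNClosure]
  exact fun p _ ↦ denseRange_stoneCechUnit p

theorem cTwo_range_stoneCechUnit [T35Space X] [SecondCountableTopology X] :
    CTwo (range (stoneCechUnit : X → StoneCech X)) :=
  isEmbedding_stoneCechUnit.toHomeomorph.symm.secondCountableTopology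

theorem IsRemotePoint.notMem_omegaNClosure [CompletelyRegularSpace X] {p : StoneCech X}
    (hp : IsRemotePoint X p) : p ∉ omegaNClosure X := by
  intro hpX
  obtain ⟨A, hAX, hA, hpA⟩ := mem_pClosure.1 hpX
  refine hp.2 _ (isNowhereDense_preimage_of_isDenseInducing isDenseInducing_stoneCechUnit hA.2) ?_
  rwa [image_preimage_eq_of_subset hAX]

theorem not_compactSpace_omegaNClosure [T35Space X] [PerfectSpace X] {p : StoneCech X}
    (hp : IsRemotePoint X p) : ¬ CompactSpace (omegaNClosure X) := by
  intro h
  have hclosed : IsClosed (omegaNClosure X) := (isCompact_iff_compactSpace.2 h).isClosed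
  have huniv : omegaNClosure X = univ :=
    hclosed.closure_eq.symm.trans dense_omegaNClosure.closure_eq
  exact hp.notMem_omegaNClosure (huniv ▸ mem_univ p)

theorem mainTheorem12_general [T3Space X] [SecondCountableTopology X] [PerfectSpace X]
    [NoncompactSpace X] :
    IsPClosed OmegaN (omegaNClosure X) ∧
    PBounded (OmegaN : Set (omegaNClosure X) → Prop) ∧
    (∃ p : StoneCech X, IsRemotePoint X p) ∧
    (∀ p : StoneCech X, IsRemotePoint X p → p ∉ omegaNClosure X) ∧
    ¬ CompactSpace (omegaNClosure X) ∧
    range stoneCechUnit ⊆ omegaNClosure X ∧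
    Dense (Subtype.val ⁻¹' range stoneCechUnit : Set (omegaNClosure X)) ∧
    CTwo (Subtype.val ⁻¹' range stoneCechUnit : Set (omegaNClosure X)) ∧
    ¬ PBounded (CTwo : Set (omegaNClosure X) → Prop) := by
  have : SeparableSpace (StoneCech X) :=
    denseRange_stoneCechUnit.separableSpace continuous_stoneCechUnit
  obtain ⟨U, hUo, hUne, hU⟩ := exists_locallyFinite_seq_isOpen (X := X)
  obtain ⟨p, hp⟩ :=
    exists_isRemotePoint isPiBase_countableBasis (countable_countableBasis X) hUo hUne hU
  have hcompact : ¬ CompactSpace (omegaNClosure X) := not_compactSpace_omegaNClosure hp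
  have hC₂ : CTwo (Subtype.val ⁻¹' range stoneCechUnit : Set (omegaNClosure X)) :=
    cTwo_preimage_val cTwo_range_stoneCechUnit _
  exact ⟨isPClosed_pClosure_omegaN _, pBounded_pClosure_omegaN _, ⟨p, hp⟩,
    fun _ ↦ IsRemotePoint.notMem_omegaNClosure, hcompact,
    range_stoneCechUnit_subset_omegaNClosure, dense_preimage_range_stoneCechUnit, hC₂,
    fun h ↦ hcompact (compactSpace_of_pBounded_of_dense h hC₂ dense_preimage_range_stoneCechUnit)⟩

end OmegaNClosure

theorem mainTheorem12 :
    -- the `ωN`-closure `X` of `ℚ` is `ωN`-closed in `βℚ`, and as a space it is `ωN`-bounded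
    IsPClosed OmegaN omegaNClosureRat ∧
    PBounded (OmegaN : Set omegaNClosureRat → Prop) ∧
    -- `ℚ` has a remote point, and no remote point of `ℚ` belongs to `X`
    (∃ p : StoneCech ℚ, IsRemotePoint ℚ p) ∧
    (∀ p : StoneCech ℚ, IsRemotePoint ℚ p → p ∉ omegaNClosureRat) ∧
    -- `X` is not compact
    ¬ CompactSpace omegaNClosureRat ∧
    -- `X` contains (the copy of) `ℚ`, which is a dense second countable subspace of `X`
    ratInBeta ⊆ omegaNClosureRat ∧
    Dense (Subtype.val ⁻¹' ratInBeta : Set omegaNClosureRat) ∧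
    CTwo (Subtype.val ⁻¹' ratInBeta : Set omegaNClosureRat) ∧
    -- `X` is not `C₂`-bounded
    ¬ PBounded (CTwo : Set omegaNClosureRat → Prop) :=
  have : PerfectSpace ℚ := perfectSpace_iff_forall_not_isolated.2 inferInstance
  mainTheorem12_general
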